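/- Let $q\in\mathbb C$ with $0<|q|<1$, and let $a_1,\dots,a_5,\lambda\in\mathbb C\setminus\{0\}$. Write $(a;q)_n=\prod_{k=0}^{n-1}(1-aq^k)$, $(a;q)_\infty=\prod_{k\ge 0}(1-aq^k)$, $(x_1,\dots,x_m;q)_n=\prod_i(x_i;q)_n$ (also for $n=\infty$), $\Omega_q=\{q^{-k}:k=0,1,2,\dots\}$, $a_{jk}=a_ja_k$ and $a_{12345}=a_1a_2a_3a_4a_5$; a sign $\pm$ in a list of parameters means that both values occur. Let $${}_8W_7(b;c_1,\dots,c_5;q,z)=\sum_{k=0}^\infty\frac{(\pm q\sqrt b,\,b,\,c_1,\dots,c_5;q)_k}{(q,\,\pm\sqrt b,\,qb/c_1,\dots,qb/c_5;q)_k}\,z^k .$$ Suppose that $\max(|a_1|,\dots,|a_5|)<1$, that $|q\lambda|<|a_{12345}|$ (where automatically $|a_{12345}|<1$), that $a_j/a_k\notin\Omega_q$ for all $j\neq k$, and that $\lambda a_j\notin\Omega_q$ for all $j$. Then the integrand below is integrable on $[-\pi,\pi]$, the five ${}_8W_7$ series below converge absolutely, and $$\int_{-\pi}^{\pi}\frac{(e^{\pm2i\psi},\lambda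 e^{\pm i\psi};q)_\infty}{(a_1e^{\pm i\psi},\dots,a_5e^{\pm i\psi};q)_\infty}\,d\psi=\frac{2\pi}{(q;q)_\infty}\Bigl(F(a_1,a_2,a_3,a_4,a_5)+\mathrm{idem}(a_1;a_2,a_3,a_4,a_5)\Bigr),$$ where $$F(a_1,\dots,a_5)=\frac{(a_1^{-2},\,a_1\lambda,\,\lambda/a_1;q)_\infty}{(a_{12},a_{13},a_{14},a_{15},\,a_2/a_1,a_3/a_1,a_4/a_1,a_5/a_1;q)_\infty}\;{}_8W_7\Bigl(a_1^2;a_{12},a_{13},a_{14},a_{15},\frac{qa_1}{\lambda};q,\frac{q\lambda}{a_{12345}}\Bigr)$$ and $\mathrm{idem}(a_1;a_2,a_3,a_4,a_5)$ denotes the sum of the four expressions obtained from the preceding one by interchanging $a_1$ with each $a_k$, $k=2,3,4,5$. -/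

import Mathlib

open scoped BigOperators

noncomputable section

/-- The `q`-shifted factorial `(a;q)_n = (1-a)(1-aq)⋯(1-aq^{n-1})`. -/
def qPoch (q a : ℂ) (n : ℕ) : ℂ := ∏ k ∈ Finset.range n, (1 - a * q ^ k)

/-- The infinite `q`-shifted factorial `(a;q)_∞ = ∏_{n≥0} (1-aq^n)` (for `|q| < 1`). -/
def qPochInf (q a : ℂ) : ℂ := ∏' n : ℕ, (1 - a * q ^ n)

/-- The set `Ω_q = {q^{-k} : k ∈ ℕ₀}`. -/
def qOmega (q : ℂ) : Set ℂ := Set.range fun k : ℕ => (q ^ k)⁻¹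

/-- The `k`-th term of the basic hypergeometric series `_{r+1}φ_s` with upper parameters `as`
(so `r + 1 = as.length`) and lower parameters `bs` (so `s = bs.length`). -/
def qHypTerm (as bs : List ℂ) (q z : ℂ) (k : ℕ) : ℂ :=
  (as.map fun a => qPoch q a k).prod / (qPoch q q k * (bs.map fun b => qPoch q b k).prod) *
    ((-1) ^ k * q ^ k.choose 2) ^ ((bs.length : ℤ) - ((as.length : ℤ) - 1)) * z ^ k

/-- The basic hypergeometric series `_{r+1}φ_s(as; bs; q, z)`. -/
def qHyp (as bs : List ℂ) (q z : ℂ) : ℂ := ∑' k : ℕ, qHypTerm as bs q z k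

/-- Upper parameters `±q√b, b, a_4, …, a_{r+1}` of a very-well-poised series. -/
def vwpUpper (q b : ℂ) (as : List ℂ) : List ℂ :=
  (q * b ^ (1 / 2 : ℂ)) :: (-(q * b ^ (1 / 2 : ℂ))) :: b :: as

/-- Lower parameters `±√b, qb/a_4, …, qb/a_{r+1}` of a very-well-poised series. -/
def vwpLower (q b : ℂ) (as : List ℂ) : List ℂ :=
  b ^ (1 / 2 : ℂ) :: (-b ^ (1 / 2 : ℂ)) :: as.map fun a => q * b / a

/-- The very-well-poised series `_{r+1}W_r(b; a_4, …, a_{r+1}; q, z)`, with `as` the list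
`a_4, …, a_{r+1}`; for a list of five parameters this is `₈W₇`. -/
def vwpW (b : ℂ) (as : List ℂ) (q z : ℂ) : ℂ := qHyp (vwpUpper q b as) (vwpLower q b as) q z

/-- Convergence of the series `_{r+1}W_r(b; a_4, …, a_{r+1}; q, z)`. -/
def VwpWConverges (b : ℂ) (as : List ℂ) (q z : ℂ) : Prop :=
  Summable (qHypTerm (vwpUpper q b as) (vwpLower q b as) q z)

/-- The symmetric sum `f(a_1, …, a_n) + idem(a_1; a_2, …, a_n)`: the sum of `f(a_1, …, a_n)` and the
expressions obtained from it by interchanging `a_1` with each `a_k`, `k = 2, …, n`.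
(Indices start at `0` here; `k = 0` gives `f a` itself.) -/
def symSum {n : ℕ} (f : (Fin (n + 1) → ℂ) → ℂ) (a : Fin (n + 1) → ℂ) : ℂ :=
  ∑ k : Fin (n + 1), f (a ∘ Equiv.swap 0 k)

/-- The integrand
`(e^{±2iψ}, l e^{±iψ}; q)_∞ / (a_1 e^{±iψ}, …, a_5 e^{±iψ}; q)_∞`. -/
def nrIntegrand (q l : ℂ) (a : Fin 5 → ℂ) (ψ : ℝ) : ℂ :=
  (qPochInf q (Complex.exp (2 * Complex.I * ψ)) * qPochInf q (Complex.exp (-(2 * Complex.I * ψ))) *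
    qPochInf q (l * Complex.exp (Complex.I * ψ)) *
    qPochInf q (l * Complex.exp (-(Complex.I * ψ)))) /
  ∏ j : Fin 5, (qPochInf q (a j * Complex.exp (Complex.I * ψ)) *
    qPochInf q (a j * Complex.exp (-(Complex.I * ψ))))

/-- The prefactor
`(a_1^{-2}, a_1 l, l/a_1; q)_∞ / (a_1a_2, …, a_1a_5, a_2/a_1, …, a_5/a_1; q)_∞`. -/
def nrCoeff (q l : ℂ) (a : Fin 5 → ℂ) : ℂ :=
  (qPochInf q ((a 0 ^ 2)⁻¹) * qPochInf q (a 0 * l) * qPochInf q (l / a 0)) /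
  ((qPochInf q (a 0 * a 1) * qPochInf q (a 0 * a 2) * qPochInf q (a 0 * a 3) *
      qPochInf q (a 0 * a 4)) *
    (qPochInf q (a 1 / a 0) * qPochInf q (a 2 / a 0) * qPochInf q (a 3 / a 0) *
      qPochInf q (a 4 / a 0)))

/-- The parameters `a_1a_2, a_1a_3, a_1a_4, a_1a_5, q a_1/l` of the `₈W₇`. -/
def nrParams (q l : ℂ) (a : Fin 5 → ℂ) : List ℂ :=
  [a 0 * a 1, a 0 * a 2, a 0 * a 3, a 0 * a 4, q * a 0 / l]

end

/-! With $z=e^{i\psi}$ the integral becomes $-i\oint_{|z|=1}K(z)\,dz/z$, where $K$ is `nrKernel`. In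
the punctured closed unit disc $K$ is holomorphic away from the points $a_jq^n$. These are pairwise
distinct because $a_j/a_k\notin\Omega_q$, so the singularities there are at most simple poles, and
they accumulate only at $0$.

Everything rests on one functional equation, `nrKernel_mul_left`: $K(qw)=R(w)K(w)$ with $R$ the
rational function `nrRatio`. It is used three times. (1) The measure $dz/z$ is invariant under
$z\mapsto qz$, so the residue at $a_1q^{n+1}$ is $R(a_1q^n)$ times the residue at $a_1q^n$. By
`nrTerm_succ` the terms of the ${}_8W_7$ obey the same recursion, so the residues are the series
terms times the residue at $a_1$, which `tendsto_sub_mul_nrKernel_zero` computes. (2) $R(w)\to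
q\lambda/a_{12345}$ as $w\to0$, of modulus less than $1$. The ratio test then gives absolute
convergence. (3) For the same reason $K$ decays geometrically on the circles $|z|=r|q|^N$
(`exists_nrKernel_bound`), so the inner contour contributes nothing in the limit.

The residue theorem on the annuli $r|q|^N\le|z|\le1$ and $N\to\infty$ give the sum of all residues.
Since $K$ is symmetric in the $a_j$, the residues at $a_kq^n$ come from those at $a_1q^n$ by a swap,
which is the idem-sum. -/

open Filter Topology

/-! ### Zeros and holomorphy of $(x;q)_\infty$. -/

section qPochhammer

variable {q : ℂ}

lemma summable_norm_neg_mul_pow (hq : ‖q‖ < 1) (x : ℂ) : Summable fun n : ℕ => ‖-(x * q ^ n)‖ := by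
  simp only [norm_neg, norm_mul, norm_pow]
  exact (summable_geometric_of_lt_one (norm_nonneg _) hq).mul_left _

lemma qPochInf_eq_tprod_one_add (q x : ℂ) : qPochInf q x = ∏' n : ℕ, (1 + -(x * q ^ n)) := by
  simp only [qPochInf, sub_eq_add_neg]

lemma qPochInf_step (hq : ‖q‖ < 1) (x : ℂ) : qPochInf q x = (1 - x) * qPochInf q (q * x) := by
  have hfun : (fun n : ℕ => 1 + -(q * x * q ^ n)) = fun n : ℕ => 1 - x * q ^ (n + 1) := by
    funext n
    ring
  have h' : Multipliable fun n : ℕ => 1 - x * q ^ (n + 1) :=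
    hfun ▸ multipliable_one_add_of_summable (summable_norm_neg_mul_pow hq (q * x))
  rw [qPochInf_eq_tprod_one_add q (q * x), hfun, qPochInf,
    tprod_eq_zero_mul' (f := fun n : ℕ => 1 - x * q ^ n) h']
  simp only [pow_zero, mul_one]

lemma qPochInf_ne_zero (hq : ‖q‖ < 1) {x : ℂ} (hx : ∀ n : ℕ, x * q ^ n ≠ 1) :
    qPochInf q x ≠ 0 := by
  rw [qPochInf_eq_tprod_one_add]
  refine tprod_one_add_ne_zero_of_summable (fun n => ?_) (summable_norm_neg_mul_pow hq x)
  rw [← sub_eq_add_neg, sub_ne_zero]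
  exact (hx n).symm

lemma qPochInf_ne_zero_of_norm_lt_one (hq : ‖q‖ < 1) {x : ℂ} (hx : ‖x‖ < 1) :
    qPochInf q x ≠ 0 := by
  refine qPochInf_ne_zero hq fun n h => ?_
  have h1 : ‖x * q ^ n‖ = 1 := by rw [h, norm_one]
  rw [norm_mul, norm_pow] at h1
  have := mul_le_of_le_one_right (norm_nonneg x) (pow_le_one₀ (n := n) (norm_nonneg q) hq.le)
  linarith

lemma qPochInf_ne_zero_of_notMem_qOmega (hq : ‖q‖ < 1) {x : ℂ} (hx : x ∉ qOmega q) :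
    qPochInf q x ≠ 0 :=
  qPochInf_ne_zero hq fun n h => hx ⟨n, (eq_inv_of_mul_eq_one_left h).symm⟩

/-- On a ball of radius $\|x\|+1$ a geometric series dominates the factors, so the product converges
locally uniformly. -/
lemma differentiable_qPochInf (hq : ‖q‖ < 1) : Differentiable ℂ (qPochInf q) := by
  intro x
  have key : HasProdLocallyUniformlyOn (fun (n : ℕ) (y : ℂ) => 1 + -(y * q ^ n))
      (fun y => ∏' n : ℕ, (1 + -(y * q ^ n))) (Metric.ball 0 (‖x‖ + 1)) := by
    refine Summable.hasProdLocallyUniformlyOn_nat_one_add Metric.isOpen_ball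
      ((summable_geometric_of_lt_one (norm_nonneg _) hq).mul_left (‖x‖ + 1))
      (Eventually.of_forall fun n y hy => ?_) (fun n => by fun_prop)
    rw [norm_neg, norm_mul, norm_pow]
    have : ‖y‖ < ‖x‖ + 1 := by simpa using hy
    gcongr
  have hd := key.differentiableOn (Eventually.of_forall fun s => by
    fun_prop) Metric.isOpen_ball
  have : qPochInf q = fun y => ∏' n : ℕ, (1 + -(y * q ^ n)) :=
    funext fun y => qPochInf_eq_tprod_one_add q y
  rw [this]
  exact hd.differentiableAt (Metric.isOpen_ball.mem_nhds (by simp))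

lemma continuous_qPochInf (hq : ‖q‖ < 1) : Continuous (qPochInf q) :=
  (differentiable_qPochInf hq).continuous

end qPochhammer

/-! ### Residue theorem on an annulus for finitely many simple poles. -/

section residues

lemma circleIntegral_sub_eq_of_differentiableAt {f : ℂ → ℂ} {r R : ℝ} (hr : 0 < r) (hrR : r ≤ R)
    (hd : ∀ z : ℂ, r ≤ ‖z‖ → ‖z‖ ≤ R → DifferentiableAt ℂ f z) :
    (∮ z in C(0, R), f z) = ∮ z in C(0, r), f z := by
  refine Complex.circleIntegral_eq_of_differentiable_on_annulus_off_countable hr hrR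
    (s := ∅) Set.countable_empty (fun z hz => ?_) (fun z hz => ?_)
  · exact (hd z (by simpa using hz.2) (by simpa using hz.1)).continuousAt.continuousWithinAt
  · have h1 : ‖z‖ < R := by simpa using hz.1.1
    have h2 : r < ‖z‖ := by simpa using hz.1.2
    exact hd z h2.le h1.le

/-- Removable singularity theorem: after subtracting the principal part, the remainder is
$o(1/(z-p))$. Redefining it at $p$ by its limit makes it differentiable there. -/
lemma exists_differentiableAt_of_tendsto_sub_mul {f : ℂ → ℂ} {p c : ℂ}
    (hd : ∀ᶠ z in 𝓝[≠] p, DifferentiableAt ℂ f z)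
    (hc : Tendsto (fun z => (z - p) * f z) (𝓝[≠] p) (𝓝 c)) :
    ∃ g : ℂ → ℂ, DifferentiableAt ℂ g p ∧ ∀ z, z ≠ p → g z = f z - c / (z - p) := by
  set g : ℂ → ℂ := fun z => f z - c / (z - p) with hg
  obtain ⟨s, hs, hs'⟩ : ∃ s ∈ 𝓝 p, ∀ z ∈ s, z ≠ p → DifferentiableAt ℂ f z := by
    rw [eventually_nhdsWithin_iff] at hd
    exact ⟨_, hd, fun z hz => hz⟩
  refine ⟨Function.update g p (limUnder (𝓝[≠] p) g), ?_, fun z hz => by simp [hz, hg]⟩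
  refine (Complex.differentiableOn_update_limUnder_of_isLittleO hs (fun z hz => ?_) ?_).differentiableAt hs
  · have hzp : z - p ≠ 0 := sub_ne_zero.2 hz.2
    have := hs' z hz.1 hz.2
    exact (this.sub (by fun_prop (disch := exact hzp))).differentiableWithinAt
  · rw [Asymptotics.isLittleO_iff_tendsto']
    · have h1 : Tendsto (fun z => (z - p) * f z - c - (z - p) * g p) (𝓝[≠] p) (𝓝 (c - c - (p - p) * g p)) := by
        refine (hc.sub tendsto_const_nhds).sub (Tendsto.mul_const _ ?_)
        exact ((continuous_id.sub continuous_const).tendsto p).mono_left nhdsWithin_le_nhds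
      simp only [sub_self, zero_mul] at h1
      refine h1.congr' ?_
      filter_upwards [self_mem_nhdsWithin] with z hz
      have hzp : z - p ≠ 0 := sub_ne_zero.2 hz
      simp only [hg]
      field_simp
    · filter_upwards [self_mem_nhdsWithin] with z hz h0
      exact absurd (inv_eq_zero.1 h0) (sub_ne_zero.2 hz)

/-- The residue theorem on an annulus, for finitely many simple poles. -/
theorem circleIntegral_sub_circleIntegral_eq_sum_residues {ι : Type*} {r R : ℝ}
    (hr : 0 < r) (hrR : r ≤ R) (S : Finset ι) (p c : ι → ℂ) (hp : Set.InjOn p S)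
    (hS : ∀ i ∈ S, r < ‖p i‖ ∧ ‖p i‖ < R) (f : ℂ → ℂ)
    (hd : ∀ z : ℂ, r ≤ ‖z‖ → ‖z‖ ≤ R → (∀ i ∈ S, z ≠ p i) → DifferentiableAt ℂ f z)
    (hc : ∀ i ∈ S, Tendsto (fun z => (z - p i) * f z) (𝓝[≠] p i) (𝓝 (c i))) :
    (∮ z in C(0, R), f z) - (∮ z in C(0, r), f z) = 2 * Real.pi * Complex.I * ∑ i ∈ S, c i := by
  classical
  induction S using Finset.induction_on generalizing f with
  | empty =>
    simp [circleIntegral_sub_eq_of_differentiableAt hr hrR fun z h1 h2 => hd z h1 h2 (by simp)]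
  | insert j S hj ih =>
    have hjS := hS j (Finset.mem_insert_self _ _)
    have hne : ∀ i ∈ S, p i ≠ p j := fun i hi h =>
      hj (hp (Finset.mem_insert_of_mem hi) (Finset.mem_insert_self _ _) h ▸ hi)
    have hnear : ∀ᶠ z in 𝓝[≠] p j, DifferentiableAt ℂ f z := by
      have e1 : ∀ᶠ z in 𝓝 (p j), r < ‖z‖ := continuous_norm.continuousAt.eventually_const_lt hjS.1
      have e2 : ∀ᶠ z in 𝓝 (p j), ‖z‖ < R := continuous_norm.continuousAt.eventually_lt_const hjS.2
      have e3 : ∀ᶠ z in 𝓝 (p j), ∀ i ∈ S, z ≠ p i :=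
        (Finset.eventually_all S).2 fun i hi => eventually_ne_nhds (hne i hi).symm
      filter_upwards [e1.filter_mono nhdsWithin_le_nhds, e2.filter_mono nhdsWithin_le_nhds,
        e3.filter_mono nhdsWithin_le_nhds, self_mem_nhdsWithin] with z h1 h2 h3 h4
      refine hd z h1.le h2.le fun i hi => ?_
      rcases Finset.mem_insert.1 hi with rfl | hi
      · exact h4
      · exact h3 i hi
    -- The induction removes one pole: `g` is `f` minus its principal part at `p j`. That part is
    -- regular at the other poles, so their residues are unchanged.
    obtain ⟨g, hgd, hg⟩ := exists_differentiableAt_of_tendsto_sub_mul hnear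
      (hc j (Finset.mem_insert_self _ _))
    have hcirc : ∀ {ρ : ℝ} {z : ℂ}, 0 < ρ → ρ ≠ ‖p j‖ → z ∈ Metric.sphere (0 : ℂ) ρ → z ≠ p j := by
      rintro ρ z hρ h hz rfl
      exact h (by simpa using hz.symm)
    have hdg : ∀ z : ℂ, r ≤ ‖z‖ → ‖z‖ ≤ R → (∀ i ∈ S, z ≠ p i) → DifferentiableAt ℂ g z := by
      intro z h1 h2 h3
      by_cases hz : z = p j
      · rwa [hz]
      · have hzp : z - p j ≠ 0 := sub_ne_zero.2 hz
        have hdf : DifferentiableAt ℂ f z := hd z h1 h2 fun i hi => by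
          rcases Finset.mem_insert.1 hi with rfl | hi
          · exact hz
          · exact h3 i hi
        have : DifferentiableAt ℂ (fun z => f z - c j / (z - p j)) z :=
          hdf.sub (by fun_prop (disch := exact hzp))
        refine this.congr_of_eventuallyEq ?_
        filter_upwards [eventually_ne_nhds hz] with w hw using hg w hw
    have ih' := ih (hp.mono (Finset.coe_subset.2 (Finset.subset_insert j S))) (fun i hi => hS i (Finset.mem_insert_of_mem hi)) g hdg
      (fun i hi => by
        have h1 := hc i (Finset.mem_insert_of_mem hi)
        have h2 : Tendsto (fun z => (z - p i) * (c j / (z - p j))) (𝓝[≠] p i)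
            (𝓝 ((p i - p i) * (c j / (p i - p j)))) := by
          have hzp : p i - p j ≠ 0 := sub_ne_zero.2 (hne i hi)
          have : ContinuousAt (fun z => (z - p i) * (c j / (z - p j))) (p i) := by
            fun_prop (disch := exact hzp)
          exact this.tendsto.mono_left nhdsWithin_le_nhds
        have h3 := h1.sub h2
        simp only [sub_self, zero_mul, sub_zero] at h3
        refine h3.congr' ?_
        filter_upwards [(eventually_ne_nhds (hne i hi)).filter_mono nhdsWithin_le_nhds] with z hz
        rw [hg z hz]
        ring)
    have hint : ∀ {ρ : ℝ}, 0 < ρ → r ≤ ρ → ρ ≤ R → (∀ i ∈ insert j S, ρ ≠ ‖p i‖) →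
        (∮ z in C(0, ρ), f z) = (∮ z in C(0, ρ), g z) + c j * ∮ z in C(0, ρ), (z - p j)⁻¹ := by
      intro ρ hρ h1 h2 h3
      have hgi : CircleIntegrable g 0 ρ := by
        refine ContinuousOn.circleIntegrable hρ.le fun z hz => ?_
        have hz' : ‖z‖ = ρ := by simpa using hz
        refine (hdg z (hz' ▸ h1) (hz' ▸ h2) fun i hi h => ?_).continuousAt.continuousWithinAt
        exact h3 i (Finset.mem_insert_of_mem hi) (by rw [← h, hz'])
      have hpi : CircleIntegrable (fun z => c j * (z - p j)⁻¹) 0 ρ := by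
        refine ContinuousOn.circleIntegrable hρ.le fun z hz => ?_
        have hzp : z - p j ≠ 0 :=
          sub_ne_zero.2 (hcirc hρ (h3 j (Finset.mem_insert_self _ _)) hz)
        have : ContinuousAt (fun z => c j * (z - p j)⁻¹) z := by fun_prop (disch := exact hzp)
        exact this.continuousWithinAt
      rw [← circleIntegral.integral_const_mul, ← circleIntegral.integral_add hgi hpi]
      refine circleIntegral.integral_congr hρ.le fun z hz => ?_
      rw [hg z (hcirc hρ (h3 j (Finset.mem_insert_self _ _)) hz)]
      ring
    have hbig : (∮ z in C(0, R), (z - p j)⁻¹) = 2 * Real.pi * Complex.I :=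
      circleIntegral.integral_sub_inv_of_mem_ball (by simpa using hjS.2)
    have hsmall : (∮ z in C(0, r), (z - p j)⁻¹) = 0 := by
      have hnz : ∀ z ∈ Metric.closedBall (0 : ℂ) r, z - p j ≠ 0 := fun z hz h => by
        have : ‖z‖ ≤ r := by simpa using hz
        rw [sub_eq_zero.1 h] at this
        exact absurd hjS.1 this.not_gt
      refine Complex.circleIntegral_eq_zero_of_differentiable_on_off_countable hr.le
        Set.countable_empty (fun z hz => ?_) (fun z hz => ?_)
      · have hzp := hnz z hz
        have : ContinuousAt (fun z => (z - p j)⁻¹) z := by fun_prop (disch := exact hzp)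
        exact this.continuousWithinAt
      · have hzp := hnz z (Metric.ball_subset_closedBall hz.1)
        fun_prop (disch := exact hzp)
    rw [hint (hr.trans_le hrR) hrR le_rfl fun i hi => (hS i hi).2.ne',
      hint hr le_rfl hrR fun i hi => (hS i hi).1.ne, hbig, hsmall, Finset.sum_insert hj,
      mul_add, ← ih']
    ring

end residues

/-! ### The $q$-difference equation of the kernel and its residues. -/

section kernel

/-- The integrand `nrIntegrand` as a function of `z = e^{iψ}`. -/
noncomputable def nrKernel (q l : ℂ) (a : Fin 5 → ℂ) (z : ℂ) : ℂ :=
  (qPochInf q (z ^ 2) * qPochInf q (z ^ 2)⁻¹ * qPochInf q (l * z) * qPochInf q (l / z)) /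
    ∏ j : Fin 5, (qPochInf q (a j * z) * qPochInf q (a j / z))

/-- The quotient `nrKernel (q w) / nrKernel w`. -/
noncomputable def nrRatio (q l : ℂ) (a : Fin 5 → ℂ) (w : ℂ) : ℂ :=
  q * (1 - q ^ 2 * w ^ 2) * (q * w - l) * (∏ j, (1 - a j * w)) /
    ((1 - w ^ 2) * (1 - l * w) * ∏ j, (q * w - a j))

variable {q l : ℂ} {a : Fin 5 → ℂ}

lemma nrIntegrand_eq_nrKernel (q l : ℂ) (a : Fin 5 → ℂ) (ψ : ℝ) :
    nrIntegrand q l a ψ = nrKernel q l a (Complex.exp (ψ * Complex.I)) := by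
  have h1 : Complex.exp (2 * Complex.I * ψ) = Complex.exp (ψ * Complex.I) ^ 2 := by
    rw [← Complex.exp_nat_mul]
    congr 1
    push_cast
    ring
  simp only [nrIntegrand, nrKernel, Complex.exp_neg, h1, div_eq_mul_inv, mul_comm Complex.I]

lemma nrKernel_comp_perm (q l : ℂ) (a : Fin 5 → ℂ) (σ : Equiv.Perm (Fin 5)) :
    nrKernel q l (a ∘ σ) = nrKernel q l a := by
  funext z
  simp only [nrKernel, Function.comp_apply]
  rw [Equiv.prod_comp σ fun j => qPochInf q (a j * z) * qPochInf q (a j / z)]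

lemma one_sub_ne_zero_of_norm_lt_one {x : ℂ} (hx : ‖x‖ < 1) : 1 - x ≠ 0 := by
  rw [sub_ne_zero]
  rintro rfl
  simp at hx

lemma norm_mul_lt_one_of_lt {x y : ℂ} (hx : ‖x‖ < 1) (hy : ‖y‖ < 1) : ‖x * y‖ < 1 := by
  rw [norm_mul]
  exact mul_lt_one_of_nonneg_of_lt_one_left (norm_nonneg _) hx hy.le

lemma norm_pow_lt_one_of_lt {x : ℂ} (hx : ‖x‖ < 1) {n : ℕ} (hn : n ≠ 0) : ‖x ^ n‖ < 1 := by
  rw [norm_pow]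
  exact pow_lt_one₀ (norm_nonneg _) hx hn

/-- Each infinite product gains or loses one factor under $w\mapsto qw$, those in $w^{\pm2}$ two.
The case $qw=a_j$ need not be excluded: both sides are then `0` by the convention for division by
zero. -/
theorem nrKernel_mul_left (hq0 : q ≠ 0) (hq : ‖q‖ < 1) (ha : ∀ j, ‖a j‖ < 1) {w : ℂ}
    (hw0 : w ≠ 0) (hw : ‖w‖ < 1) (hlw : 1 - l * w ≠ 0) :
    nrKernel q l a (q * w) = nrRatio q l a w * nrKernel q l a w := by
  have hw2 : ‖w ^ 2‖ < 1 := norm_pow_lt_one_of_lt hw two_ne_zero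
  have d1 : 1 - w ^ 2 ≠ 0 := one_sub_ne_zero_of_norm_lt_one hw2
  have d2 : 1 - q * w ^ 2 ≠ 0 := one_sub_ne_zero_of_norm_lt_one (norm_mul_lt_one_of_lt hq hw2)
  have d3 : ∏ j, (1 - a j * w) ≠ 0 := Finset.prod_ne_zero_iff.2 fun j _ =>
    one_sub_ne_zero_of_norm_lt_one (norm_mul_lt_one_of_lt (ha j) hw)
  have e1 : qPochInf q ((q * w) ^ 2) = qPochInf q (w ^ 2) / ((1 - w ^ 2) * (1 - q * w ^ 2)) := by
    rw [qPochInf_step hq (w ^ 2), qPochInf_step hq (q * w ^ 2),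
      show q * (q * w ^ 2) = (q * w) ^ 2 by ring]
    field_simp
  have e2 : qPochInf q ((q * w) ^ 2)⁻¹ =
      (1 - ((q * w) ^ 2)⁻¹) * (1 - (q * w ^ 2)⁻¹) * qPochInf q (w ^ 2)⁻¹ := by
    rw [qPochInf_step hq ((q * w) ^ 2)⁻¹, qPochInf_step hq (q * ((q * w) ^ 2)⁻¹),
      show q * ((q * w) ^ 2)⁻¹ = (q * w ^ 2)⁻¹ by field_simp,
      show q * (q * w ^ 2)⁻¹ = (w ^ 2)⁻¹ by field_simp]
    ring
  have e3 : qPochInf q (l * (q * w)) = qPochInf q (l * w) / (1 - l * w) := by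
    rw [qPochInf_step hq (l * w), show q * (l * w) = l * (q * w) by ring]
    field_simp
  have e4 : qPochInf q (l / (q * w)) = (1 - l / (q * w)) * qPochInf q (l / w) := by
    rw [qPochInf_step hq (l / (q * w)), show q * (l / (q * w)) = l / w by field_simp]
  have e5 : ∏ j, (qPochInf q (a j * (q * w)) * qPochInf q (a j / (q * w))) =
      (∏ j, (q * w - a j)) * (∏ j, (qPochInf q (a j * w) * qPochInf q (a j / w))) /
        ((∏ j, (1 - a j * w)) * (q * w) ^ 5) := by
    rw [eq_div_iff (mul_ne_zero d3 (by positivity)), ← Finset.prod_mul_distrib]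
    have : (q * w) ^ 5 = ∏ _j : Fin 5, (q * w) := by simp
    rw [this, ← Finset.prod_mul_distrib, ← Finset.prod_mul_distrib]
    refine Finset.prod_congr rfl fun j _ => ?_
    rw [qPochInf_step hq (a j * w), qPochInf_step hq (a j / (q * w)),
      show q * (a j * w) = a j * (q * w) by ring,
      show q * (a j / (q * w)) = a j / w by field_simp]
    field_simp
  rw [nrKernel, nrKernel, nrRatio, e1, e2, e3, e4, e5]
  generalize ∏ j, (qPochInf q (a j * w) * qPochInf q (a j / w)) = D
  generalize ∏ j, (q * w - a j) = E
  generalize ∏ j, (1 - a j * w) = F at *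
  have key : (1 - ((q * w) ^ 2)⁻¹) * (1 - (q * w ^ 2)⁻¹) * (1 - l / (q * w)) * (q * w) ^ 5 /
      ((1 - w ^ 2) * (1 - q * w ^ 2) * (1 - l * w)) =
      q * (1 - q ^ 2 * w ^ 2) * (q * w - l) / ((1 - w ^ 2) * (1 - l * w)) := by
    field_simp
    ring
  simp only [div_eq_mul_inv, mul_inv, inv_inv] at key ⊢
  linear_combination (F * qPochInf q (w ^ 2) * qPochInf q (w ^ 2)⁻¹ * qPochInf q (l * w) *
    qPochInf q (l * w⁻¹) * E⁻¹ * D⁻¹) * key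

lemma differentiableAt_nrKernel (hq : ‖q‖ < 1) {z : ℂ} (hz : z ≠ 0)
    (h : ∀ j, qPochInf q (a j * z) ≠ 0) (h' : ∀ j, qPochInf q (a j / z) ≠ 0) :
    DifferentiableAt ℂ (nrKernel q l a) z := by
  have hd : ∀ g : ℂ → ℂ, DifferentiableAt ℂ g z → DifferentiableAt ℂ (fun z => qPochInf q (g z)) z :=
    fun g hg => (differentiable_qPochInf hq (g z)).comp z hg
  have hz2 : z ^ 2 ≠ 0 := pow_ne_zero 2 hz
  refine DifferentiableAt.div (((DifferentiableAt.mul ?_ ?_).mul ?_).mul ?_)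
    (DifferentiableAt.fun_finsetProd fun j _ => DifferentiableAt.mul ?_ ?_)
    (Finset.prod_ne_zero_iff.2 fun j _ => mul_ne_zero (h j) (h' j))
  all_goals
    refine hd _ ?_
    fun_prop (disch := assumption)

lemma qHypTerm_vwp_five (q b c₁ c₂ c₃ c₄ c₅ z : ℂ) (n : ℕ) :
    qHypTerm (vwpUpper q b [c₁, c₂, c₃, c₄, c₅]) (vwpLower q b [c₁, c₂, c₃, c₄, c₅]) q z n =
      (qPoch q (q * b ^ (1 / 2 : ℂ)) n * qPoch q (-(q * b ^ (1 / 2 : ℂ))) n * qPoch q b n *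
        qPoch q c₁ n * qPoch q c₂ n * qPoch q c₃ n * qPoch q c₄ n * qPoch q c₅ n) /
      (qPoch q q n * qPoch q (b ^ (1 / 2 : ℂ)) n * qPoch q (-b ^ (1 / 2 : ℂ)) n *
        qPoch q (q * b / c₁) n * qPoch q (q * b / c₂) n * qPoch q (q * b / c₃) n *
        qPoch q (q * b / c₄) n * qPoch q (q * b / c₅) n) * z ^ n := by
  simp [qHypTerm, vwpUpper, vwpLower, mul_assoc]

lemma qPoch_succ (q x : ℂ) (n : ℕ) : qPoch q x (n + 1) = qPoch q x n * (1 - x * q ^ n) :=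
  Finset.prod_range_succ _ _

/-- The terms of the very-well-poised series attached to the parameter `a 0`. -/
noncomputable def nrTerm (q l : ℂ) (a : Fin 5 → ℂ) (n : ℕ) : ℂ :=
  qHypTerm (vwpUpper q (a 0 ^ 2) (nrParams q l a)) (vwpLower q (a 0 ^ 2) (nrParams q l a)) q
    (q * l / ∏ j, a j) n

lemma nrTerm_zero (q l : ℂ) (a : Fin 5 → ℂ) : nrTerm q l a 0 = 1 := by
  simp [nrTerm, nrParams, qHypTerm_vwp_five, qPoch]

/-- The quotient of consecutive series terms is matched factor by factor with `nrRatio` at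
$w=a_1q^n$. The index `j = 0` of the products there supplies the factors from $(b;q)_n$ and
$(q;q)_n$. -/
theorem nrTerm_succ (hq0 : q ≠ 0) (hq : ‖q‖ < 1) (hl : l ≠ 0) (ha0 : ∀ j, a j ≠ 0)
    (ha1 : ∀ j, ‖a j‖ < 1) (hratio : ∀ j, j ≠ 0 → a 0 / a j ∉ qOmega q)
    (hlow : l * a 0 ∉ qOmega q) (n : ℕ) :
    nrTerm q l a (n + 1) = nrRatio q l a (a 0 * q ^ n) * nrTerm q l a n := by
  have hqn : q ^ n ≠ 0 := pow_ne_zero n hq0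
  have hQ : ‖q ^ n‖ ≤ 1 := by
    rw [norm_pow]
    exact pow_le_one₀ (norm_nonneg _) hq.le
  have hw : ‖a 0 * q ^ n‖ < 1 := by
    rw [norm_mul]
    exact mul_lt_one_of_nonneg_of_lt_one_left (norm_nonneg _) (ha1 0) hQ
  have d0 : 1 - q * q ^ n ≠ 0 := by
    refine one_sub_ne_zero_of_norm_lt_one ?_
    rw [norm_mul]
    exact mul_lt_one_of_nonneg_of_lt_one_left (norm_nonneg _) hq hQ
  have d1 : 1 - a 0 * q ^ n ≠ 0 := one_sub_ne_zero_of_norm_lt_one hw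
  have d2 : 1 + a 0 * q ^ n ≠ 0 := by
    have : 1 - -(a 0 * q ^ n) ≠ 0 := one_sub_ne_zero_of_norm_lt_one (by rwa [norm_neg])
    rwa [sub_neg_eq_add] at this
  have d3 : 1 - l * (a 0 * q ^ n) ≠ 0 := fun h => hlow ⟨n, by
    rw [inv_eq_iff_eq_inv]
    exact eq_inv_of_mul_eq_one_right (by linear_combination -h)⟩
  have d4 : ∀ j, j ≠ 0 → a j - q * (a 0 * q ^ n) ≠ 0 := fun j hj h => hratio j hj ⟨n + 1, by
    have := ha0 j
    simp only
    rw [inv_eq_iff_eq_inv, inv_div, eq_div_iff (ha0 0), pow_succ]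
    linear_combination -h⟩
  have e1 := d4 1 (by decide)
  have e2 := d4 2 (by decide)
  have e3 := d4 3 (by decide)
  have e4 := d4 4 (by decide)
  have f0 := ha0 0
  have f1 := ha0 1
  have f2 := ha0 2
  have f3 := ha0 3
  have f4 := ha0 4
  simp only [nrTerm, nrParams, qHypTerm_vwp_five, qPoch_succ, nrRatio, Fin.prod_univ_five]
  have arrange : ∀ A₁ A₂ A₃ A₄ A₅ A₆ A₇ A₈ B₁ B₂ B₃ B₄ B₅ B₆ B₇ B₈ x₁ x₂ x₃ x₄ x₅ x₆ x₇ x₈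
      y₁ y₂ y₃ y₄ y₅ y₆ y₇ y₈ z Z : ℂ,
      (A₁ * x₁ * (A₂ * x₂) * (A₃ * x₃) * (A₄ * x₄) * (A₅ * x₅) * (A₆ * x₆) * (A₇ * x₇) *
        (A₈ * x₈)) / (B₁ * y₁ * (B₂ * y₂) * (B₃ * y₃) * (B₄ * y₄) * (B₅ * y₅) * (B₆ * y₆) *
        (B₇ * y₇) * (B₈ * y₈)) * (Z * z) =
      (x₁ * x₂ * (x₃ * x₄ * x₅ * x₆ * x₇ * x₈) / (y₂ * y₃ * (y₁ * y₄ * y₅ * y₆ * y₇ * y₈)) * z) *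
      (A₁ * A₂ * A₃ * A₄ * A₅ * A₆ * A₇ * A₈ /
        (B₁ * B₂ * B₃ * B₄ * B₅ * B₆ * B₇ * B₈) * Z) := by
    intros
    simp only [div_eq_mul_inv, mul_inv]
    ring
  rw [pow_succ _ n, arrange]
  congr 1
  -- The principal root of `a 0 ^ 2` may be `-a 0`; only its square matters, because the parameters
  -- $\pm\sqrt b$ and $\pm q\sqrt b$ occur in pairs.
  have hs : ((a 0 ^ 2) ^ (1 / 2 : ℂ)) ^ 2 = a 0 ^ 2 := by
    rw [← Complex.cpow_nat_mul]
    simp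
  generalize (a 0 ^ 2) ^ (1 / 2 : ℂ) = s at hs
  generalize q ^ n = Q at *
  have hnum : (1 - q * s * Q) * (1 - -(q * s) * Q) = 1 - q ^ 2 * (a 0 * Q) ^ 2 := by
    linear_combination (-q ^ 2 * Q ^ 2) * hs
  have hden : (1 - s * Q) * (1 - -s * Q) = (1 - a 0 * Q) * (1 + a 0 * Q) := by
    linear_combination (-Q ^ 2) * hs
  rw [hnum, hden]
  generalize a 0 = b at *
  generalize a 1 = c₁ at *
  generalize a 2 = c₂ at *
  generalize a 3 = c₃ at *
  generalize a 4 = c₄ at *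
  have g : ∀ c, c ≠ 0 → 1 - q * b ^ 2 / (b * c) * Q = (c - q * (b * Q)) / c := fun c hc => by
    field_simp
  have g5 : 1 - q * b ^ 2 / (q * b / l) * Q = 1 - l * (b * Q) := by
    field_simp
  have g6 : 1 - q * b / l * Q = (l - q * (b * Q)) / l := by
    field_simp
  have g0 : q * (b * Q) - b = - (b * (1 - q * Q)) := by ring
  have g7 : 1 - (b * Q) ^ 2 = (1 - b * Q) * (1 + b * Q) := by ring
  rw [g c₁ f1, g c₂ f2, g c₃ f3, g c₄ f4, g5, g6, g0, g7, ← neg_sub c₁, ← neg_sub c₂, ← neg_sub c₃,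
    ← neg_sub c₄, ← neg_sub l]
  generalize c₁ - q * (b * Q) = u₁ at *
  generalize c₂ - q * (b * Q) = u₂ at *
  generalize c₃ - q * (b * Q) = u₃ at *
  generalize c₄ - q * (b * Q) = u₄ at *
  generalize l - q * (b * Q) = u₅ at *
  field_simp

/-- Isolates a factor such as $dd^{-1}$, so that `ring` can prove the rest while treating inverses
as atoms. -/
lemma eq_of_eq_mul_of_eq_one {x y u : ℂ} (hu : u = 1) (h : x = y * u) : x = y := by
  rw [h, hu, mul_one]

/-- The pole comes from the factor $1-a_1/z=(z-a_1)/z$ of $(a_1/z;q)_\infty$; the remaining function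
`g` is continuous at $a_1$. -/
theorem tendsto_sub_mul_nrKernel_zero (hq : ‖q‖ < 1) (ha0 : a 0 ≠ 0)
    (ha1 : ∀ j, ‖a j‖ < 1) (hratio : ∀ j, j ≠ 0 → a j / a 0 ∉ qOmega q) :
    Tendsto (fun z => (z - a 0) * (nrKernel q l a z / z)) (𝓝[≠] (a 0))
      (𝓝 (nrCoeff q l a / qPochInf q q)) := by
  have hb := ha0
  have hP : ∀ j, qPochInf q (a j * a 0) ≠ 0 := fun j =>
    qPochInf_ne_zero_of_norm_lt_one hq (norm_mul_lt_one_of_lt (ha1 j) (ha1 0))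
  have hP' : ∀ j, j ≠ 0 → qPochInf q (a j / a 0) ≠ 0 := fun j hj =>
    qPochInf_ne_zero_of_notMem_qOmega hq (hratio j hj)
  have hPq : qPochInf q q ≠ 0 := qPochInf_ne_zero_of_norm_lt_one hq hq
  set g : ℂ → ℂ := fun z =>
    (qPochInf q (z ^ 2) * qPochInf q (z ^ 2)⁻¹ * qPochInf q (l * z) * qPochInf q (l / z)) /
      (qPochInf q (a 0 * z) * qPochInf q (q * (a 0 / z)) *
        (qPochInf q (a 1 * z) * qPochInf q (a 1 / z)) *
        (qPochInf q (a 2 * z) * qPochInf q (a 2 / z)) *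
        (qPochInf q (a 3 * z) * qPochInf q (a 3 / z)) *
        (qPochInf q (a 4 * z) * qPochInf q (a 4 / z))) with hg
  have hden : (qPochInf q (a 0 * a 0) * qPochInf q (q * (a 0 / a 0)) *
        (qPochInf q (a 1 * a 0) * qPochInf q (a 1 / a 0)) *
        (qPochInf q (a 2 * a 0) * qPochInf q (a 2 / a 0)) *
        (qPochInf q (a 3 * a 0) * qPochInf q (a 3 / a 0)) *
        (qPochInf q (a 4 * a 0) * qPochInf q (a 4 / a 0))) ≠ 0 := by
    rw [div_self hb, mul_one]
    simp [hP, hP', hPq]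
  have hcomp : ∀ f : ℂ → ℂ, ContinuousAt f (a 0) →
      ContinuousAt (fun z => qPochInf q (f z)) (a 0) := fun f hf =>
    (continuous_qPochInf hq).continuousAt.comp hf
  have hb2 : a 0 ^ 2 ≠ 0 := pow_ne_zero 2 hb
  have hgc : ContinuousAt g (a 0) := by
    refine ContinuousAt.div ?_ ?_ hden
    · refine ((ContinuousAt.mul ?_ ?_).mul ?_).mul ?_
      all_goals
        refine hcomp _ ?_
        fun_prop (disch := assumption)
    · refine ((((ContinuousAt.mul ?_ ?_).mul (ContinuousAt.mul ?_ ?_)).mul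
        (ContinuousAt.mul ?_ ?_)).mul (ContinuousAt.mul ?_ ?_)).mul (ContinuousAt.mul ?_ ?_)
      all_goals
        refine hcomp _ ?_
        fun_prop (disch := assumption)
  -- At $z=a_1$ the numerator factor $(z^2;q)_\infty$ cancels the denominator factor
  -- $(a_1z;q)_\infty$.
  have hval : g (a 0) = nrCoeff q l a / qPochInf q q := by
    have h0 := hP 0
    rw [← pow_two] at h0
    simp only [hg, nrCoeff, div_self hb, mul_one]
    rw [mul_comm (a 0) (a 1), mul_comm (a 0) (a 2), mul_comm (a 0) (a 3), mul_comm (a 0) (a 4),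
      mul_comm (a 0) l, ← pow_two]
    simp only [div_eq_mul_inv, mul_inv]
    generalize qPochInf q (a 0 ^ 2) = X at *
    refine eq_of_eq_mul_of_eq_one (mul_inv_cancel₀ h0) ?_
    ring
  rw [← hval]
  refine (hgc.tendsto.mono_left nhdsWithin_le_nhds).congr' ?_
  filter_upwards [self_mem_nhdsWithin,
    (eventually_ne_nhds hb).filter_mono nhdsWithin_le_nhds] with z hz hz0
  have hzb : z - a 0 ≠ 0 := sub_ne_zero.2 hz
  simp only [hg, nrKernel, Fin.prod_univ_five]
  rw [qPochInf_step hq (a 0 / z), show 1 - a 0 / z = (z - a 0) / z by field_simp]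
  simp only [div_eq_mul_inv, mul_inv, inv_inv]
  generalize z - a 0 = d at *
  have h : d * d⁻¹ * (z * z⁻¹) = 1 := by
    rw [mul_inv_cancel₀ hzb, mul_inv_cancel₀ hz0, one_mul]
  refine (eq_of_eq_mul_of_eq_one h ?_).symm
  ring

/-- The residue of `nrKernel z / z` at `z = a 0 * q ^ n`. -/
theorem tendsto_sub_mul_nrKernel (hq0 : q ≠ 0) (hq : ‖q‖ < 1) (hl : l ≠ 0) (ha0 : ∀ j, a j ≠ 0)
    (ha1 : ∀ j, ‖a j‖ < 1) (hratio : ∀ j k, j ≠ k → a j / a k ∉ qOmega q)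
    (hlow : l * a 0 ∉ qOmega q) (n : ℕ) :
    Tendsto (fun z => (z - a 0 * q ^ n) * (nrKernel q l a z / z)) (𝓝[≠] (a 0 * q ^ n))
      (𝓝 (nrCoeff q l a / qPochInf q q * nrTerm q l a n)) := by
  induction n with
  | zero =>
    simpa [nrTerm_zero] using
      tendsto_sub_mul_nrKernel_zero hq (ha0 0) ha1 fun j hj => hratio j 0 hj
  | succ n ih =>
    have hqn : q ^ n ≠ 0 := pow_ne_zero n hq0
    set w := a 0 * q ^ n with hwdef
    have hw0 : w ≠ 0 := mul_ne_zero (ha0 0) hqn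
    have hw : ‖w‖ < 1 := by
      rw [hwdef, norm_mul, norm_pow]
      exact mul_lt_one_of_nonneg_of_lt_one_left (norm_nonneg _) (ha1 0)
        (pow_le_one₀ (norm_nonneg _) hq.le)
    have hlw : 1 - l * w ≠ 0 := fun h => hlow ⟨n, by
      rw [inv_eq_iff_eq_inv]
      exact eq_inv_of_mul_eq_one_right (by linear_combination -h)⟩
    have hqw : a 0 * q ^ (n + 1) = q * w := by rw [hwdef]; ring
    have hE : ∏ j, (q * w - a j) ≠ 0 := by
      refine Finset.prod_ne_zero_iff.2 fun j _ h => ?_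
      rcases eq_or_ne j 0 with rfl | hj
      · have h2 : a 0 * (1 - q * q ^ n) = 0 := by linear_combination -h
        refine mul_ne_zero (ha0 0) (one_sub_ne_zero_of_norm_lt_one ?_) h2
        rw [← pow_succ']
        exact norm_pow_lt_one_of_lt hq n.succ_ne_zero
      · refine hratio 0 j hj.symm ⟨n + 1, ?_⟩
        have := ha0 j
        simp only
        rw [inv_eq_iff_eq_inv, inv_div, eq_div_iff (ha0 0), pow_succ]
        linear_combination h
    have hRc : ContinuousAt (nrRatio q l a) w := by
      have hw2 : 1 - w ^ 2 ≠ 0 :=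
        one_sub_ne_zero_of_norm_lt_one (norm_pow_lt_one_of_lt hw two_ne_zero)
      have hd := mul_ne_zero (mul_ne_zero hw2 hlw) hE
      unfold nrRatio
      fun_prop (disch := exact hd)
    have hmain := (hRc.tendsto.mono_left nhdsWithin_le_nhds).mul ih
    rw [hqw, nrTerm_succ hq0 hq hl ha0 ha1 (fun j hj => hratio 0 j hj.symm) hlow, ← hwdef]
    rw [mul_left_comm] at hmain
    -- Substituting $z=qv$ turns $(z-qw)K(z)/z$ into $R(v)\,(v-w)K(v)/v$: the two factors $q$
    -- cancel.
    have hdiv : Tendsto (fun z => z / q) (𝓝[≠] (q * w)) (𝓝[≠] w) := by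
      refine tendsto_nhdsWithin_iff.2 ⟨?_, ?_⟩
      · have h1 : ContinuousAt (fun z : ℂ => z / q) (q * w) := by fun_prop
        have h2 := h1.tendsto.mono_left (nhdsWithin_le_nhds (s := {q * w}ᶜ))
        rwa [mul_div_cancel_left₀ w hq0] at h2
      · filter_upwards [self_mem_nhdsWithin] with z hz h
        refine hz ?_
        rw [Set.mem_singleton_iff] at h ⊢
        rw [← h, mul_div_cancel₀ _ hq0]
    have hc := hmain.comp hdiv
    refine hc.congr' ?_
    have ev : ∀ᶠ v in 𝓝[≠] w, v ≠ 0 ∧ ‖v‖ < 1 ∧ 1 - l * v ≠ 0 := by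
      have c1 : ContinuousAt (fun v : ℂ => 1 - l * v) w := by fun_prop
      exact ((eventually_ne_nhds hw0).and ((continuous_norm.continuousAt.eventually_lt_const hw).and
        (c1.eventually_ne hlw))).filter_mono nhdsWithin_le_nhds
    filter_upwards [hdiv.eventually ev] with z hz
    obtain ⟨v, rfl⟩ : ∃ v, z = q * v := ⟨z / q, by field_simp⟩
    simp only [Function.comp_apply]
    rw [mul_div_cancel_left₀ _ hq0] at hz ⊢
    obtain ⟨hv0, hv1, hv2⟩ := hz
    rw [nrKernel_mul_left hq0 hq ha1 hv0 hv1 hv2]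
    field_simp

end kernel

/-! ### Decay near the origin and summation of all residues. -/

section integral

variable {q l : ℂ} {a : Fin 5 → ℂ}

lemma tendsto_nrRatio_zero (ha0 : ∀ j, a j ≠ 0) :
    Tendsto (nrRatio q l a) (𝓝 0) (𝓝 (q * l / ∏ j, a j)) := by
  have hE : ∏ j, (q * 0 - a j) ≠ 0 :=
    Finset.prod_ne_zero_iff.2 fun j _ => by simpa using ha0 j
  have hd : (1 - (0 : ℂ) ^ 2) * (1 - l * 0) * ∏ j, (q * 0 - a j) ≠ 0 :=
    mul_ne_zero (by norm_num) hE
  have hc : ContinuousAt (nrRatio q l a) 0 := by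
    unfold nrRatio
    fun_prop (disch := exact hd)
  have hval : nrRatio q l a 0 = q * l / ∏ j, a j := by
    rw [nrRatio, div_eq_div_iff hd (Finset.prod_ne_zero_iff.2 fun j _ => ha0 j)]
    simp only [Fin.prod_univ_five]
    ring
  rw [← hval]
  exact hc.tendsto

lemma exists_nrRatio_bound (ha0 : ∀ j, a j ≠ 0) (harg : ‖q * l‖ < ‖∏ j, a j‖) :
    ∃ ρ : ℝ, 0 ≤ ρ ∧ ρ < 1 ∧ ∀ᶠ w in 𝓝 0, ‖nrRatio q l a w‖ ≤ ρ := by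
  have h : ‖q * l / ∏ j, a j‖ < 1 := by
    rw [norm_div]
    exact (div_lt_one ((norm_nonneg _).trans_lt harg)).2 harg
  obtain ⟨ρ, h1, h2⟩ := exists_between h
  exact ⟨ρ, (norm_nonneg _).trans h1.le, h2,
    ((tendsto_nrRatio_zero ha0).norm.eventually_lt_const h1).mono fun _ h => h.le⟩

lemma summable_nrTerm (hq0 : q ≠ 0) (hq : ‖q‖ < 1) (hl : l ≠ 0) (ha0 : ∀ j, a j ≠ 0)
    (ha1 : ∀ j, ‖a j‖ < 1) (harg : ‖q * l‖ < ‖∏ j, a j‖)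
    (hratio : ∀ j, j ≠ 0 → a 0 / a j ∉ qOmega q) (hlow : l * a 0 ∉ qOmega q) :
    Summable (nrTerm q l a) := by
  obtain ⟨ρ, -, hρ, h⟩ := exists_nrRatio_bound ha0 harg
  refine summable_of_ratio_norm_eventually_le hρ ?_
  have ht : Tendsto (fun n : ℕ => a 0 * q ^ n) atTop (𝓝 0) := by
    simpa using (tendsto_pow_atTop_nhds_zero_of_norm_lt_one hq).const_mul (a 0)
  filter_upwards [ht.eventually h] with n hn
  rw [nrTerm_succ hq0 hq hl ha0 ha1 hratio hlow, norm_mul]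
  gcongr

/-- For $|z|\le1$ the factors $(a_jz;q)_\infty$ cannot vanish, so only $(a_j/z;q)_\infty$ produces
poles. -/
lemma differentiableAt_nrKernel_of_norm_le_one (hq : ‖q‖ < 1) (ha1 : ∀ j, ‖a j‖ < 1) {z : ℂ}
    (hz0 : z ≠ 0) (hz1 : ‖z‖ ≤ 1) (hz : ∀ j (n : ℕ), z ≠ a j * q ^ n) :
    DifferentiableAt ℂ (nrKernel q l a) z := by
  refine differentiableAt_nrKernel hq hz0 (fun j => ?_) fun j => ?_
  · refine qPochInf_ne_zero_of_norm_lt_one hq ?_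
    rw [norm_mul]
    exact mul_lt_one_of_nonneg_of_lt_one_left (norm_nonneg _) (ha1 j) hz1
  · refine qPochInf_ne_zero hq fun n h => hz j n ?_
    field_simp at h
    exact h.symm

lemma mul_pow_norm_lt_one (hq : ‖q‖ < 1) {x : ℂ} (hx : ‖x‖ < 1) (n : ℕ) : ‖x * q ^ n‖ < 1 := by
  rw [norm_mul, norm_pow]
  exact mul_lt_one_of_nonneg_of_lt_one_left (norm_nonneg _) hx (pow_le_one₀ (norm_nonneg _) hq.le)

lemma continuous_nrIntegrand (hq : ‖q‖ < 1) (ha1 : ∀ j, ‖a j‖ < 1) :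
    Continuous (nrIntegrand q l a) := by
  rw [funext (nrIntegrand_eq_nrKernel q l a), continuous_iff_continuousAt]
  intro ψ
  have hn := Complex.norm_exp_ofReal_mul_I ψ
  have hk : ContinuousAt (nrKernel q l a) (Complex.exp (ψ * Complex.I)) := by
    refine (differentiableAt_nrKernel_of_norm_le_one hq ha1 (Complex.exp_ne_zero _) hn.le
      fun j n h => ?_).continuousAt
    have := mul_pow_norm_lt_one hq (ha1 j) n
    rw [← h, hn] at this
    exact lt_irrefl _ this
  exact ContinuousAt.comp (f := fun ψ : ℝ => Complex.exp (ψ * Complex.I)) hk (by fun_prop)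

lemma circleIntegral_nrKernel (q l : ℂ) (a : Fin 5 → ℂ) :
    (∮ z in C(0, 1), nrKernel q l a z / z) =
      Complex.I * ∫ ψ in (-Real.pi)..Real.pi, nrIntegrand q l a ψ := by
  have hper : Function.Periodic (nrIntegrand q l a) (2 * Real.pi) := fun ψ => by
    rw [nrIntegrand_eq_nrKernel, nrIntegrand_eq_nrKernel]
    congr 1
    push_cast
    rw [add_mul, Complex.exp_add, Complex.exp_two_pi_mul_I, mul_one]
  -- The circle integral is parametrised over $[0,2\pi]$; periodicity moves it to $[-\pi,\pi]$.
  have hp := hper.intervalIntegral_add_eq (-Real.pi) 0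
  rw [show -Real.pi + 2 * Real.pi = Real.pi by ring, zero_add] at hp
  rw [hp, circleIntegral, ← intervalIntegral.integral_const_mul]
  refine intervalIntegral.integral_congr fun θ _ => ?_
  have he := Complex.exp_ne_zero (θ * Complex.I)
  simp only [deriv_circleMap, circleMap, Complex.ofReal_one, one_mul, zero_add, smul_eq_mul,
    nrIntegrand_eq_nrKernel]
  field_simp

lemma exists_radius_avoiding (q : ℂ) (a : Fin 5 → ℂ) {δ : ℝ} (hδ : 0 < δ) :
    ∃ r : ℝ, 0 < r ∧ r < δ ∧ ∀ j (m : ℤ), r ≠ ‖a j‖ * ‖q‖ ^ m := by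
  have hc : (Set.range fun p : Fin 5 × ℤ => ‖a p.1‖ * ‖q‖ ^ p.2).Countable :=
    Set.countable_range _
  obtain ⟨r, hr, h1, h2⟩ := (hc.dense_compl ℝ).exists_between hδ
  exact ⟨r, h1, h2, fun j m h => hr ⟨(j, m), h.symm⟩⟩

/-- `C` bounds the kernel on the circle of radius `r` by compactness, and each contraction by $q$
multiplies the bound by $\rho\ge|R|$. -/
lemma exists_nrKernel_bound (hq0 : q ≠ 0) (hq : ‖q‖ < 1) (ha0 : ∀ j, a j ≠ 0)
    (ha1 : ∀ j, ‖a j‖ < 1) (harg : ‖q * l‖ < ‖∏ j, a j‖) :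
    ∃ r C ρ : ℝ, 0 < r ∧ r < 1 ∧ 0 ≤ ρ ∧ ρ < 1 ∧
      (∀ j (n N : ℕ), ‖a j * q ^ n‖ ≠ r * ‖q‖ ^ N) ∧
      ∀ (N : ℕ) (w : ℂ), ‖w‖ = r * ‖q‖ ^ N → ‖nrKernel q l a w‖ ≤ C * ρ ^ N := by
  have hq0' : ‖q‖ ≠ 0 := norm_ne_zero_iff.2 hq0
  obtain ⟨ρ, hρ0, hρ1, hρ⟩ := exists_nrRatio_bound ha0 harg
  have hlz : ∀ᶠ w : ℂ in 𝓝 0, 1 - l * w ≠ 0 := by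
    have h : ContinuousAt (fun w : ℂ => 1 - l * w) 0 := by fun_prop
    exact h.eventually_ne (by simp)
  obtain ⟨δ, hδ, hball⟩ := Metric.eventually_nhds_iff.1 (hρ.and hlz)
  obtain ⟨r, hr0, hr, havoid⟩ := exists_radius_avoiding q a (lt_min one_pos hδ)
  have hr1 : r < 1 := hr.trans_le (min_le_left _ _)
  have hrδ : r < δ := hr.trans_le (min_le_right _ _)
  -- A pole on some circle would give $r=|a_j||q|^{n-N}$ with a possibly negative exponent, hence
  -- the integer powers in `havoid`.
  have hne : ∀ j (n N : ℕ), ‖a j * q ^ n‖ ≠ r * ‖q‖ ^ N := fun j n N h => by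
    refine havoid j ((n : ℤ) - N) ?_
    rw [zpow_sub₀ hq0', zpow_natCast, zpow_natCast, ← mul_div_assoc,
      eq_div_iff (pow_ne_zero N hq0'), ← h, norm_mul, norm_pow]
  obtain ⟨C, hC⟩ : ∃ C, ∀ w ∈ Metric.sphere (0 : ℂ) r, ‖nrKernel q l a w‖ ≤ C := by
    refine (isCompact_sphere (0 : ℂ) r).exists_bound_of_continuousOn fun w hw => ?_
    have hw' : ‖w‖ = r := by simpa using hw
    refine (differentiableAt_nrKernel_of_norm_le_one hq ha1 ?_ (hw'.trans_lt hr1).le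
      fun j n h => ?_).continuousAt.continuousWithinAt
    · exact norm_pos_iff.1 (hw' ▸ hr0)
    · exact hne j n 0 (by rw [← h, hw', pow_zero, mul_one])
  refine ⟨r, C, ρ, hr0, hr1, hρ0, hρ1, hne, fun N => ?_⟩
  induction N with
  | zero => exact fun w hw => by simpa using hC w (by simpa using hw)
  | succ N ih =>
    intro w hw
    obtain ⟨v, rfl⟩ : ∃ v, w = q * v := ⟨w / q, by field_simp⟩
    have hv : ‖v‖ = r * ‖q‖ ^ N := by
      rw [norm_mul, pow_succ] at hw
      exact mul_left_cancel₀ hq0' (hw.trans (by ring))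
    have hvr : ‖v‖ ≤ r := by
      rw [hv]
      exact mul_le_of_le_one_right hr0.le (pow_le_one₀ (norm_nonneg _) hq.le)
    have hv0 : v ≠ 0 := norm_pos_iff.1 (by rw [hv]; positivity)
    obtain ⟨h1, h2⟩ := hball (y := v) (by simpa using hvr.trans_lt hrδ)
    rw [nrKernel_mul_left hq0 hq ha1 hv0 (hvr.trans_lt hr1) h2, norm_mul, pow_succ]
    calc _ ≤ ρ * (C * ρ ^ N) := mul_le_mul h1 (ih v hv) (norm_nonneg _) hρ0
      _ = _ := by ring

/-- A coincidence between different $j,k$ would make $a_j/a_k$ or its inverse a power $q^{-d}$,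
$d\ge0$; for equal indices $0<|q|<1$ decides. -/
lemma injective_mul_pow (hq0 : q ≠ 0) (hq : ‖q‖ < 1) (ha0 : ∀ j, a j ≠ 0)
    (hratio : ∀ j k, j ≠ k → a j / a k ∉ qOmega q) :
    Function.Injective fun i : Fin 5 × ℕ => a i.1 * q ^ i.2 := by
  have key : ∀ j k (n m : ℕ), n ≤ m → a j * q ^ n = a k * q ^ m → j = k := by
    intro j k n m hnm h
    by_contra hjk
    obtain ⟨d, rfl⟩ := Nat.exists_eq_add_of_le hnm
    refine hratio k j (Ne.symm hjk) ⟨d, ?_⟩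
    have h' : a j = a k * q ^ d := by
      refine mul_right_cancel₀ (pow_ne_zero n hq0) (h.trans ?_)
      ring
    have := ha0 k
    have := pow_ne_zero d hq0
    simp only
    rw [h']
    field_simp
  rintro ⟨j, n⟩ ⟨k, m⟩ h
  simp only at h
  have hjk : j = k := (le_total n m).elim (fun hnm => key j k n m hnm h)
    fun hmn => (key k j m n hmn h.symm).symm
  subst hjk
  have h2 : ‖q‖ ^ n = ‖q‖ ^ m := by
    rw [← norm_pow, ← norm_pow, mul_left_cancel₀ (ha0 j) h]
  rw [pow_right_injective₀ (norm_pos_iff.2 hq0) hq.ne h2]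

/-- The contour integral over the unit circle as the sum of all residues inside it. -/
theorem circleIntegral_nrKernel_eq_tsum_residues (hq0 : q ≠ 0) (hq : ‖q‖ < 1) (ha0 : ∀ j, a j ≠ 0)
    (ha1 : ∀ j, ‖a j‖ < 1) (harg : ‖q * l‖ < ‖∏ j, a j‖)
    (hratio : ∀ j k, j ≠ k → a j / a k ∉ qOmega q) (c : Fin 5 × ℕ → ℂ) (hc : Summable c)
    (hres : ∀ i, Tendsto (fun z => (z - a i.1 * q ^ i.2) * (nrKernel q l a z / z))
      (𝓝[≠] (a i.1 * q ^ i.2)) (𝓝 (c i))) :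
    (∮ z in C(0, 1), nrKernel q l a z / z) = 2 * Real.pi * Complex.I * ∑' i, c i := by
  obtain ⟨r, C, ρ, hr0, hr1, hρ0, hρ1, hne, hbound⟩ := exists_nrKernel_bound hq0 hq ha0 ha1 harg
  have hqpos : 0 < ‖q‖ := norm_pos_iff.2 hq0
  have hfin : ∀ N : ℕ, {i : Fin 5 × ℕ | r * ‖q‖ ^ N < ‖a i.1 * q ^ i.2‖}.Finite := by
    intro N
    obtain ⟨K, hK⟩ := exists_pow_lt_of_lt_one (show 0 < r * ‖q‖ ^ N by positivity) hq
    refine ((Set.finite_univ (α := Fin 5)).prod (Set.finite_Iio K)).subset fun i hi => ?_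
    refine ⟨trivial, ?_⟩
    rw [Set.mem_Iio]
    by_contra! hKi
    have h1 : ‖q‖ ^ i.2 ≤ ‖q‖ ^ K := pow_le_pow_of_le_one hqpos.le hq.le hKi
    have h2 : ‖a i.1 * q ^ i.2‖ ≤ ‖q‖ ^ i.2 := by
      rw [norm_mul, norm_pow]
      exact mul_le_of_le_one_left (by positivity) (ha1 _).le
    have h3 : r * ‖q‖ ^ N < ‖a i.1 * q ^ i.2‖ := hi
    linarith
  -- `S N` indexes the poles in the $N$-th annulus. These sets increase and exhaust all indices, so
  -- the finite residue sums tend to the full sum.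
  set S : ℕ → Finset (Fin 5 × ℕ) := fun N => (hfin N).toFinset with hSdef
  have hS : ∀ N i, i ∈ S N ↔ r * ‖q‖ ^ N < ‖a i.1 * q ^ i.2‖ := fun N i => by simp [hSdef]
  have hrN : Tendsto (fun N : ℕ => r * ‖q‖ ^ N) atTop (𝓝 0) := by
    simpa using (tendsto_pow_atTop_nhds_zero_of_lt_one hqpos.le hq).const_mul r
  have hStop : Tendsto S atTop atTop := by
    refine tendsto_atTop_finset_of_monotone (fun N M hNM i hi => ?_) fun i => ?_
    · rw [hS] at hi ⊢
      refine lt_of_le_of_lt ?_ hi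
      exact mul_le_mul_of_nonneg_left (pow_le_pow_of_le_one hqpos.le hq.le hNM) hr0.le
    · have : 0 < ‖a i.1 * q ^ i.2‖ := norm_pos_iff.2 (mul_ne_zero (ha0 _) (pow_ne_zero _ hq0))
      obtain ⟨N, hN⟩ := (hrN.eventually_lt_const this).exists
      exact ⟨N, (hS N i).2 hN⟩
  have hsum : Tendsto (fun N => 2 * Real.pi * Complex.I * ∑ i ∈ S N, c i) atTop
      (𝓝 (2 * Real.pi * Complex.I * ∑' i, c i)) :=
    (hc.hasSum.comp hStop).const_mul _
  have hsmall : Tendsto (fun N : ℕ => ∮ z in C(0, r * ‖q‖ ^ N), nrKernel q l a z / z) atTop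
      (𝓝 0) := by
    refine squeeze_zero_norm (a := fun N => 2 * Real.pi * (C * ρ ^ N)) (fun N => ?_) ?_
    · have hpos : 0 < r * ‖q‖ ^ N := by positivity
      refine (circleIntegral.norm_integral_le_of_norm_le_const (C := C * ρ ^ N / (r * ‖q‖ ^ N))
        hpos.le fun z hz => ?_).trans_eq ?_
      · have hz' : ‖z‖ = r * ‖q‖ ^ N := by simpa using hz
        rw [norm_div, hz']
        exact div_le_div_of_nonneg_right (hbound N z hz') hpos.le
      · field_simp
    · simpa using ((tendsto_pow_atTop_nhds_zero_of_lt_one hρ0 hρ1).const_mul C).const_mul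
        (2 * Real.pi)
  have heq : ∀ N : ℕ, (∮ z in C(0, 1), nrKernel q l a z / z) -
      (∮ z in C(0, r * ‖q‖ ^ N), nrKernel q l a z / z) =
      2 * Real.pi * Complex.I * ∑ i ∈ S N, c i := by
    intro N
    have hpos : 0 < r * ‖q‖ ^ N := by positivity
    have hle : r * ‖q‖ ^ N ≤ 1 :=
      mul_le_one₀ hr1.le (by positivity) (pow_le_one₀ hqpos.le hq.le)
    refine circleIntegral_sub_circleIntegral_eq_sum_residues hpos hle (S N)
      (fun i => a i.1 * q ^ i.2) c (injective_mul_pow hq0 hq ha0 hratio).injOn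
      (fun i hi => ⟨(hS N i).1 hi, mul_pow_norm_lt_one hq (ha1 _) _⟩) _ (fun z h1 h2 h3 => ?_)
      fun i _ => hres i
    have hz0 : z ≠ 0 := norm_pos_iff.1 (hpos.trans_le h1)
    refine (differentiableAt_nrKernel_of_norm_le_one hq ha1 hz0 h2 fun j n h => ?_).div
      differentiableAt_id hz0
    refine h3 (j, n) ((hS N _).2 (lt_of_le_of_ne ?_ (hne j n N).symm)) h
    rwa [← h]
  have hlim := (tendsto_const_nhds (x := ∮ z in C(0, 1), nrKernel q l a z / z)).sub hsmall
  simp only [heq, sub_zero] at hlim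
  exact tendsto_nhds_unique hlim hsum

end integral

/-! ### Assembly of the integral formula. -/

theorem mainTheorem7 (q l : ℂ) (a : Fin 5 → ℂ)
    (hq0 : q ≠ 0) (hq1 : ‖q‖ < 1) (hl : l ≠ 0)
    (ha0 : ∀ j, a j ≠ 0) (ha1 : ∀ j, ‖a j‖ < 1)
    (harg : ‖q * l‖ < ‖∏ j, a j‖)
    (hratio : ∀ j k, j ≠ k → a j / a k ∉ qOmega q)
    (hlow : ∀ j, l * a j ∉ qOmega q) :
    IntervalIntegrable (nrIntegrand q l a) MeasureTheory.volume (-Real.pi) Real.pi ∧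
    (∀ k : Fin 5, VwpWConverges (a k ^ 2) (nrParams q l (a ∘ Equiv.swap 0 k)) q
      (q * l / ∏ j, a j)) ∧
    ∫ ψ in (-Real.pi)..Real.pi, nrIntegrand q l a ψ =
      2 * Real.pi / qPochInf q q *
        symSum (fun c : Fin 5 → ℂ =>
          nrCoeff q l c * vwpW (c 0 ^ 2) (nrParams q l c) q (q * l / ∏ j, c j)) a := by
  have hratio' : ∀ i j k, j ≠ k →
      (a ∘ Equiv.swap 0 i) j / (a ∘ Equiv.swap 0 i) k ∉ qOmega q := fun i j k hjk =>
    hratio _ _ ((Equiv.swap 0 i).injective.ne hjk)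
  have hprod : ∀ i, ∏ j, (a ∘ Equiv.swap 0 i) j = ∏ j, a j := fun i =>
    Equiv.prod_comp (Equiv.swap 0 i) a
  have hzero : ∀ i, (a ∘ Equiv.swap 0 i) 0 = a i := fun i => by simp
  have hsum : ∀ i, Summable (nrTerm q l (a ∘ Equiv.swap 0 i)) := fun i =>
    summable_nrTerm (a := a ∘ Equiv.swap 0 i) hq0 hq1 hl (fun _ => ha0 _) (fun _ => ha1 _) (by rwa [hprod])
      (fun j hj => hratio' i 0 j hj.symm) (hlow _)
  refine ⟨(continuous_nrIntegrand hq1 ha1).intervalIntegrable _ _, fun k => ?_, ?_⟩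
  · have h := hsum k
    unfold nrTerm at h
    rwa [hprod, hzero] at h
  set c : Fin 5 × ℕ → ℂ := fun i => nrCoeff q l (a ∘ Equiv.swap 0 i.1) / qPochInf q q *
    nrTerm q l (a ∘ Equiv.swap 0 i.1) i.2 with hcdef
  have hcs : ∀ i, Summable fun n => c (i, n) := fun i => by
    simp only [hcdef]
    exact Summable.mul_left _ (hsum i)
  have hc : Summable c := Summable.of_norm <| (summable_prod_of_nonneg fun _ => norm_nonneg _).2
    ⟨fun i => Summable.norm (hcs i), Summable.of_finite⟩
  have hlim : ∀ i : Fin 5 × ℕ, Tendsto (fun z => (z - a i.1 * q ^ i.2) * (nrKernel q l a z / z))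
      (𝓝[≠] (a i.1 * q ^ i.2)) (𝓝 (c i)) := fun i => by
    have h := tendsto_sub_mul_nrKernel (a := a ∘ Equiv.swap 0 i.1) hq0 hq1 hl (fun _ => ha0 _)
      (fun _ => ha1 _) (hratio' i.1)
      (hlow _) i.2
    -- Symmetry of the kernel turns the residue at the first parameter of the swapped tuple into the
    -- residue at `a i.1 * q ^ i.2`.
    rw [nrKernel_comp_perm, hzero] at h
    exact h
  have hres := circleIntegral_nrKernel_eq_tsum_residues hq0 hq1 ha0 ha1 harg hratio c hc hlim
  rw [circleIntegral_nrKernel, hc.tsum_prod, tsum_fintype] at hres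
  refine mul_left_cancel₀ Complex.I_ne_zero (hres.trans ?_)
  have hfin : ∑ i, ∑' n, c (i, n) = (qPochInf q q)⁻¹ * symSum (fun c : Fin 5 → ℂ =>
      nrCoeff q l c * vwpW (c 0 ^ 2) (nrParams q l c) q (q * l / ∏ j, c j)) a := by
    rw [symSum, Finset.mul_sum]
    refine Finset.sum_congr rfl fun i _ => ?_
    simp only [hcdef]
    rw [tsum_mul_left, vwpW, qHyp]
    simp only [nrTerm]
    ring
  rw [hfin]
  ring
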